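/- Let $\sigma>0$, $\sigma_0>0$, $\mu\in\mathbb{R}$, and let $X$ be a real random variable with normal distribution $\mathcal N(\mu,\sigma_0^2)$. For $f\in L^2(\mathbb{R},\mathbb{C})$ let $\hat f$ denote the unitary Fourier transform, the $L^2$-extension of $\hat f(t)=\frac1{\sqrt{2\pi}}\int_{\mathbb{R}} f(x)e^{-itx}\,dx$. Let $\mathcal H_G$ be the reproducing kernel Hilbert space of real-valued functions of the Gaussian kernel $k_G(x,y)=\frac{1}{\sqrt{2\pi}\,\sigma}\exp\left(-\frac{(x-y)^2}{2\sigma^2}\right)$ on $\mathbb{R}$, that is, the real Hilbert space $$\mathcal H_G=\left\{f\in L^2(\mathbb{R},\mathbb{R}) : \int_{\mathbb{R}}|\hat f(t)|^2\exp\left(\tfrac{\sigma^2}{2}t^2\right)dt<\infty\right\},\qquad \langle f,g\rangle_{\mathcal H_G}=\int_{\mathbb{R}}\hat f(t)\,\overline{\hat g(t)}\,\exp\left(\tfrac{\sigma^2}{2}t^2\right)dt .$$ Let $C_{XX}:\mathcal H_G\to\mathcal H_G$ be the covariance operator of $X$, i.e. the bounded linear operator determined by $\langle C_{XX}f,g\rangle_{\mathcal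 H_G}=E[f(X)g(X)]$ for all $f,g\in\mathcal H_G$. Then for every $a\in\mathbb{R}$ the function $k_a(x)=\exp\left(-\frac{(x-a)^2}{2\sigma^2}\right)$ satisfies $k_a\in\mathcal H_G\setminus\mathrm{Ran}(C_{XX})$. In particular, $C_{XX}$ is not surjective. -/

import Mathlib

/-!
If `C_XX f = k_a`, then pairing with `k_b` and using the definition of `C_XX` gives, for every `b`,
`∫ f(x) p(x) k_b(x) dx = ⟨k_a, k_b⟩ = √(2π) σ k_0(b - a)`, where `p` is the density of `X`. The left
side is the convolution of the integrable function `f p` with the Gaussian `k_0`, and the right side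
is a multiple of a translate of `k_0`. As the Fourier transform of `k_0` has no zeros, that of `f p`
must be a constant times a phase, so it does not vanish at infinity: this contradicts the
Riemann–Lebesgue lemma.
-/

open MeasureTheory ProbabilityTheory FourierTransform

noncomputable section

namespace KernelBayes

/-- A real `L²` function regarded as a complex one. -/
def complexify (f : Lp ℝ 2 (volume : Measure ℝ)) : Lp ℂ 2 (volume : Measure ℝ) :=
  Complex.ofRealCLM.compLp f

/-- The unitary Fourier transform on `L²(ℝ, ℂ)` in the angular frequency normalisation, i.e. the
`L²` extension of `f ↦ (t ↦ (2π)^(-1/2) ∫ f(x) exp(-itx) dx)`. Mathlib's `𝓕` is the `L²` extension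
of `f ↦ (ξ ↦ ∫ f(x) exp(-2πixξ) dx)`, hence the rescaling. -/
def fourierL2 (f : Lp ℂ 2 (volume : Measure ℝ)) (t : ℝ) : ℂ :=
  ((√(2 * Real.pi))⁻¹ : ℝ) * (𝓕 f : Lp ℂ 2 (volume : Measure ℝ)) (t / (2 * Real.pi))

theorem two_pi_pos : (0 : ℝ) < 2 * Real.pi := by positivity

theorem quasi_dilate :
    Measure.QuasiMeasurePreserving (fun t : ℝ => t / (2 * Real.pi)) volume volume := by
  have h := Measure.quasiMeasurePreserving_smul (volume : Measure ℝ)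
    (r := (2 * Real.pi)⁻¹) (inv_ne_zero two_pi_pos.ne')
  simpa only [smul_eq_mul, div_eq_mul_inv, mul_comm] using h

theorem fourierL2_sq_integrable (f : Lp ℂ 2 (volume : Measure ℝ)) :
    Integrable (fun t => ‖fourierL2 f t‖ ^ 2) := by
  have h1 : Integrable (fun t : ℝ => ‖(𝓕 f : Lp ℂ 2 (volume : Measure ℝ)) t‖ ^ 2) :=
    (memLp_two_iff_integrable_sq_norm (Lp.aestronglyMeasurable _)).1 (Lp.memLp _)
  have h2 := (h1.comp_div two_pi_pos.ne').const_mul (((√(2 * Real.pi))⁻¹) ^ 2)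
  refine h2.congr (Filter.Eventually.of_forall fun t => ?_)
  simp only [fourierL2, norm_mul, mul_pow, Complex.norm_real, Real.norm_eq_abs, sq_abs]

theorem fourierL2_aesm (f : Lp ℂ 2 (volume : Measure ℝ)) :
    AEStronglyMeasurable (fourierL2 f) volume :=
  ((Lp.aestronglyMeasurable (𝓕 f : Lp ℂ 2 (volume : Measure ℝ))).comp_quasiMeasurePreserving
    quasi_dilate).const_mul _

theorem fourierL2_memLp (f : Lp ℂ 2 (volume : Measure ℝ)) : MemLp (fourierL2 f) 2 volume :=
  (memLp_two_iff_integrable_sq_norm (fourierL2_aesm f)).2 (fourierL2_sq_integrable f)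

theorem fourierL2_add (f g : Lp ℂ 2 (volume : Measure ℝ)) :
    fourierL2 (f + g) =ᵐ[volume] fun t => fourierL2 f t + fourierL2 g t := by
  have h : (𝓕 (f + g) : Lp ℂ 2 (volume : Measure ℝ)) = 𝓕 f + 𝓕 g :=
    (Lp.fourierTransformₗᵢ ℝ ℂ).map_add f g
  have h2 := quasi_dilate.ae
    (Lp.coeFn_add (𝓕 f : Lp ℂ 2 (volume : Measure ℝ)) (𝓕 g : Lp ℂ 2 (volume : Measure ℝ)))
  filter_upwards [h2] with t ht
  simp only [fourierL2, h, ht, Pi.add_apply, mul_add]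

theorem fourierL2_smul (c : ℂ) (f : Lp ℂ 2 (volume : Measure ℝ)) :
    fourierL2 (c • f) =ᵐ[volume] fun t => c * fourierL2 f t := by
  have h : (𝓕 (c • f) : Lp ℂ 2 (volume : Measure ℝ)) = c • 𝓕 f :=
    (Lp.fourierTransformₗᵢ ℝ ℂ).map_smul c f
  have h2 := quasi_dilate.ae
    (Lp.coeFn_smul c (𝓕 f : Lp ℂ 2 (volume : Measure ℝ)))
  filter_upwards [h2] with t ht
  simp only [fourierL2, h, ht, Pi.smul_apply, smul_eq_mul]
  ring

theorem norm_sq_eq_integral (f : Lp ℂ 2 (volume : Measure ℝ)) :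
    ‖f‖ ^ 2 = ∫ t, ‖f t‖ ^ 2 := by
  rw [← inner_self_eq_norm_sq (𝕜 := ℂ) f, L2.inner_def, ← integral_re (L2.integrable_inner f f)]
  simp only [inner_self_eq_norm_sq]

theorem fourierL2_integral (f : Lp ℂ 2 (volume : Measure ℝ)) :
    ∫ t, ‖fourierL2 f t‖ ^ 2 = ‖f‖ ^ 2 := by
  have e : ∀ t, ‖fourierL2 f t‖ ^ 2 = (2 * Real.pi)⁻¹ *
      (fun s => ‖(𝓕 f : Lp ℂ 2 (volume : Measure ℝ)) s‖ ^ 2) (t / (2 * Real.pi)) := by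
    intro t
    simp only [fourierL2, norm_mul, mul_pow, Complex.norm_real, Real.norm_eq_abs, sq_abs, inv_pow,
      Real.sq_sqrt two_pi_pos.le]
  simp_rw [e]
  rw [integral_const_mul,
    Measure.integral_comp_div (fun s => ‖(𝓕 f : Lp ℂ 2 (volume : Measure ℝ)) s‖ ^ 2), abs_of_pos two_pi_pos, smul_eq_mul,
    ← mul_assoc, inv_mul_cancel₀ two_pi_pos.ne', one_mul, ← norm_sq_eq_integral, Lp.norm_fourier_eq]

theorem complexify_add (f g : Lp ℝ 2 (volume : Measure ℝ)) :
    complexify (f + g) = complexify f + complexify g :=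
  (Complex.ofRealCLM.compLpL 2 volume).map_add f g

theorem complexify_smul (c : ℝ) (f : Lp ℝ 2 (volume : Measure ℝ)) :
    complexify (c • f) = (c : ℂ) • complexify f :=
  (Complex.ofRealCLM.compLpL 2 volume).map_smul c f

theorem norm_complexify (f : Lp ℝ 2 (volume : Measure ℝ)) : ‖complexify f‖ = ‖f‖ := by
  rw [Lp.norm_def, Lp.norm_def]
  congr 1
  apply eLpNorm_congr_norm_ae
  filter_upwards [Complex.ofRealCLM.coeFn_compLp f] with t ht
  simp [complexify, ht]

/-- `f̂` for a real-valued `f ∈ L²(ℝ)`. -/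
def fourierReal (f : Lp ℝ 2 (volume : Measure ℝ)) : ℝ → ℂ := fourierL2 (complexify f)

theorem fourierReal_add (f g : Lp ℝ 2 (volume : Measure ℝ)) :
    fourierReal (f + g) =ᵐ[volume] fun t => fourierReal f t + fourierReal g t := by
  unfold fourierReal
  rw [complexify_add]
  exact fourierL2_add _ _

theorem fourierReal_smul (c : ℝ) (f : Lp ℝ 2 (volume : Measure ℝ)) :
    fourierReal (c • f) =ᵐ[volume] fun t => (c : ℂ) * fourierReal f t := by
  unfold fourierReal
  rw [complexify_smul]
  exact fourierL2_smul _ _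

/-- The unitary Fourier transform as an isometry from real to complex `L²`. -/
def fourierIsometry : Lp ℝ 2 (volume : Measure ℝ) →ₗᵢ[ℝ] Lp ℂ 2 (volume : Measure ℝ) where
  toFun f := (fourierL2_memLp (complexify f)).toLp _
  map_add' f g := by
    rw [← MemLp.toLp_add]
    exact MemLp.toLp_congr _ _ (fourierReal_add f g)
  map_smul' c f := by
    rw [RingHom.id_apply, ← MemLp.toLp_const_smul]
    refine MemLp.toLp_congr _ _ ((fourierReal_smul c f).trans ?_)
    exact Filter.Eventually.of_forall fun t => by simp [fourierReal]
  norm_map' f := by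
    rw [← sq_eq_sq₀ (norm_nonneg _) (norm_nonneg _)]
    change ‖(fourierL2_memLp (complexify f)).toLp _‖ ^ 2 = _
    rw [← norm_complexify f, ← fourierL2_integral (complexify f), norm_sq_eq_integral]
    apply integral_congr_ae
    filter_upwards [(fourierL2_memLp (complexify f)).coeFn_toLp] with t ht
    rw [ht]

theorem fourierIsometry_ae (f : Lp ℝ 2 (volume : Measure ℝ)) :
    fourierIsometry f =ᵐ[volume] fourierReal f :=
  (fourierL2_memLp (complexify f)).coeFn_toLp

/-- `f̂(t) exp(σ² t² / 4)`, whose square is the weighted density in the norm below. -/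
def weighted (σ : ℝ) (f : Lp ℝ 2 (volume : Measure ℝ)) (t : ℝ) : ℂ :=
  (Real.exp (σ ^ 2 / 4 * t ^ 2) : ℂ) * fourierReal f t

theorem exp_quarter_sq (σ t : ℝ) :
    Real.exp (σ ^ 2 / 4 * t ^ 2) ^ 2 = Real.exp (σ ^ 2 / 2 * t ^ 2) := by
  rw [← Real.exp_nat_mul]
  congr 1
  push_cast
  ring

theorem norm_weighted_sq (σ : ℝ) (f : Lp ℝ 2 (volume : Measure ℝ)) (t : ℝ) :
    ‖weighted σ f t‖ ^ 2 = ‖fourierReal f t‖ ^ 2 * Real.exp (σ ^ 2 / 2 * t ^ 2) := by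
  rw [weighted, norm_mul, mul_pow, Complex.norm_real, Real.norm_eq_abs, sq_abs, exp_quarter_sq,
    mul_comm]

theorem weighted_memLp_iff (σ : ℝ) (f : Lp ℝ 2 (volume : Measure ℝ)) :
    MemLp (weighted σ f) 2 volume ↔
      Integrable (fun t => ‖fourierReal f t‖ ^ 2 * Real.exp (σ ^ 2 / 2 * t ^ 2)) := by
  have h : AEStronglyMeasurable (weighted σ f) volume := by
    refine AEStronglyMeasurable.mul ?_ (fourierL2_aesm _)
    exact (by fun_prop : Continuous fun t : ℝ =>
      (Real.exp (σ ^ 2 / 4 * t ^ 2) : ℂ)).aestronglyMeasurable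
  rw [memLp_two_iff_integrable_sq_norm h]
  simp_rw [norm_weighted_sq]

theorem weighted_add (σ : ℝ) (f g : Lp ℝ 2 (volume : Measure ℝ)) :
    weighted σ (f + g) =ᵐ[volume] weighted σ f + weighted σ g := by
  filter_upwards [fourierReal_add f g] with t ht
  simp [weighted, ht, mul_add]

theorem weighted_smul (σ c : ℝ) (f : Lp ℝ 2 (volume : Measure ℝ)) :
    weighted σ (c • f) =ᵐ[volume] c • weighted σ f := by
  filter_upwards [fourierReal_smul c f] with t ht
  simp only [weighted, ht, Pi.smul_apply, Complex.real_smul]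
  ring

/-- The linear space of all `f ∈ L²(ℝ)`, real valued, with
`∫ |f̂(t)|² exp(σ² t² / 2) dt < ∞`. -/
def gaussianSubmodule (σ : ℝ) : Submodule ℝ (Lp ℝ 2 (volume : Measure ℝ)) where
  carrier := {f | Integrable (fun t => ‖fourierReal f t‖ ^ 2 * Real.exp (σ ^ 2 / 2 * t ^ 2))}
  zero_mem' := by
    rw [Set.mem_ofPred_eq, ← weighted_memLp_iff]
    have h := weighted_smul σ 0 0
    rw [zero_smul, zero_smul] at h
    exact (memLp_congr_ae h).2 MemLp.zero
  add_mem' {f g} hf hg := by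
    rw [Set.mem_ofPred_eq, ← weighted_memLp_iff] at *
    exact (memLp_congr_ae (weighted_add σ f g)).2 (hf.add hg)
  smul_mem' c f hf := by
    rw [Set.mem_ofPred_eq, ← weighted_memLp_iff] at *
    exact (memLp_congr_ae (weighted_smul σ c f)).2 (hf.const_smul c)

/-- The real reproducing kernel Hilbert space `H_G` of the Gaussian kernel
`k_G(x, y) = (√(2π) σ)⁻¹ exp(-(x - y)² / (2σ²))`, `σ > 0`, in its Fourier description: all real
`f ∈ L²(ℝ)` with `∫ |f̂(t)|² exp(σ² t² / 2) dt < ∞`. This is a separate type, because it carries its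
own inner product and not that of `L²`. -/
def GaussianRKHS (σ : ℝ) : Type := gaussianSubmodule σ

namespace GaussianRKHS

variable {σ : ℝ}

instance : AddCommGroup (GaussianRKHS σ) := inferInstanceAs (AddCommGroup (gaussianSubmodule σ))

instance : Module ℝ (GaussianRKHS σ) := inferInstanceAs (Module ℝ (gaussianSubmodule σ))

/-- The underlying square integrable function (an almost everywhere class). -/
def toL2 : GaussianRKHS σ →ₗ[ℝ] Lp ℝ 2 (volume : Measure ℝ) := (gaussianSubmodule σ).subtype

theorem toL2_injective : Function.Injective (toL2 (σ := σ)) := Subtype.val_injective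

theorem weighted_memLp (f : GaussianRKHS σ) : MemLp (weighted σ (toL2 f)) 2 volume :=
  (weighted_memLp_iff σ _).2 (Subtype.property f)

/-- `f ↦ f̂(t) exp(σ² t² / 4)`, as a linear map into `L²(ℝ, ℂ)`. -/
def embed (σ : ℝ) : GaussianRKHS σ →ₗ[ℝ] Lp ℂ 2 (volume : Measure ℝ) where
  toFun f := (weighted_memLp f).toLp _
  map_add' f g := by
    rw [← MemLp.toLp_add]
    exact MemLp.toLp_congr _ _ (weighted_add σ _ _)
  map_smul' c f := by
    rw [RingHom.id_apply, ← MemLp.toLp_const_smul]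
    exact MemLp.toLp_congr _ _ (weighted_smul σ c _)

theorem embed_ae (f : GaussianRKHS σ) : embed σ f =ᵐ[volume] weighted σ (toL2 f) :=
  (weighted_memLp f).coeFn_toLp

/-- The inner product `∫ f̂(t) conj(ĝ(t)) exp(σ² t² / 2) dt`. For real-valued `f` and `g` this
integral is a real number; the real part only turns it into an element of `ℝ`. -/
def innerG (f g : GaussianRKHS σ) : ℝ :=
  (∫ t : ℝ, fourierReal (toL2 f) t * (starRingEnd ℂ) (fourierReal (toL2 g) t) *
    (Real.exp (σ ^ 2 / 2 * t ^ 2) : ℂ)).re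

theorem innerG_eq (f g : GaussianRKHS σ) :
    innerG f g = (inner ℂ (embed σ g) (embed σ f)).re := by
  rw [L2.inner_def, innerG]
  congr 1
  apply integral_congr_ae
  filter_upwards [embed_ae f, embed_ae g] with t hf hg
  rw [hf, hg, RCLike.inner_apply, weighted, weighted, ← exp_quarter_sq]
  simp only [map_mul, Complex.conj_ofReal]
  push_cast
  ring

theorem norm_toL2_le_embed (f : GaussianRKHS σ) : ‖toL2 f‖ ≤ ‖embed σ f‖ := by
  rw [← fourierIsometry.norm_map]
  apply Lp.norm_le_norm_of_ae_le
  filter_upwards [embed_ae f, fourierIsometry_ae (toL2 f)] with t h1 h2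
  rw [h1, h2, weighted, norm_mul, Complex.norm_real, Real.norm_eq_abs, Real.abs_exp]
  exact le_mul_of_one_le_left (norm_nonneg _) (Real.one_le_exp (by positivity))

/-- `H_G` with the inner product `innerG`. -/
@[reducible] def core (σ : ℝ) : InnerProductSpace.Core ℝ (GaussianRKHS σ) where
  inner := innerG
  conj_inner_symm f g := by
    change innerG g f = innerG f g
    rw [innerG_eq, innerG_eq]
    exact inner_re_symm (𝕜 := ℂ) _ _
  re_inner_nonneg f := by
    change 0 ≤ innerG f f
    rw [innerG_eq]
    exact inner_self_nonneg (𝕜 := ℂ)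
  add_left f g h := by
    change innerG (f + g) h = innerG f h + innerG g h
    simp only [innerG_eq, map_add, inner_add_right, Complex.add_re]
  smul_left f g r := by
    change innerG (r • f) g = r * innerG f g
    simp only [innerG_eq, map_smul, inner_smul_right_eq_smul, Complex.real_smul,
      Complex.re_ofReal_mul]
  definite f hf := by
    change innerG f f = 0 at hf
    rw [innerG_eq] at hf
    have h0 : ‖embed σ f‖ ^ 2 = 0 := (inner_self_eq_norm_sq (𝕜 := ℂ) (embed σ f)).symm.trans hf
    have h1 : ‖embed σ f‖ = 0 := by simpa using h0
    have h2 : toL2 f = 0 := norm_le_zero_iff.1 ((norm_toL2_le_embed f).trans h1.le)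
    exact toL2_injective (h2.trans (map_zero _).symm)

instance instNormedAddCommGroup : NormedAddCommGroup (GaussianRKHS σ) :=
  (core σ).toNormedAddCommGroup

instance instInnerProductSpace : InnerProductSpace ℝ (GaussianRKHS σ) :=
  InnerProductSpace.ofCore (core σ).toCore

theorem inner_def (f g : GaussianRKHS σ) : inner ℝ f g = innerG f g := rfl

theorem norm_embed (f : GaussianRKHS σ) : ‖embed σ f‖ = ‖f‖ := by
  rw [← sq_eq_sq₀ (norm_nonneg _) (norm_nonneg _), ← real_inner_self_eq_norm_sq f, inner_def,
    innerG_eq]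
  exact (inner_self_eq_norm_sq (𝕜 := ℂ) (embed σ f)).symm

theorem norm_toL2_le (f : GaussianRKHS σ) : ‖toL2 f‖ ≤ ‖f‖ :=
  (norm_toL2_le_embed f).trans_eq (norm_embed f)

theorem norm_exp_neg_le (σ t : ℝ) : ‖(Real.exp (-(σ ^ 2 / 4 * t ^ 2)) : ℂ)‖ ≤ 1 := by
  rw [Complex.norm_real, Real.norm_eq_abs, Real.abs_exp, Real.exp_le_one_iff]
  have : 0 ≤ σ ^ 2 / 4 * t ^ 2 := by positivity
  linarith

theorem damp_memLp (σ : ℝ) (F : Lp ℂ 2 (volume : Measure ℝ)) :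
    MemLp (fun t => (Real.exp (-(σ ^ 2 / 4 * t ^ 2)) : ℂ) * F t) 2 volume := by
  have h : Continuous fun t : ℝ => (Real.exp (-(σ ^ 2 / 4 * t ^ 2)) : ℂ) := by fun_prop
  refine (Lp.memLp F).mono (h.aestronglyMeasurable.mul (Lp.aestronglyMeasurable F)) ?_
  refine Filter.Eventually.of_forall fun t => ?_
  rw [norm_mul]
  exact mul_le_of_le_one_left (norm_nonneg _) (norm_exp_neg_le σ t)

/-- Multiplication by `exp(-σ² t² / 4)` on `L²(ℝ, ℂ)`. -/
def damp (σ : ℝ) : Lp ℂ 2 (volume : Measure ℝ) →L[ℂ] Lp ℂ 2 (volume : Measure ℝ) :=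
  LinearMap.mkContinuous
    { toFun := fun F => (damp_memLp σ F).toLp _
      map_add' := fun F G => by
        rw [← MemLp.toLp_add]
        refine MemLp.toLp_congr _ _ ?_
        filter_upwards [Lp.coeFn_add F G] with t ht
        simp only [ht, Pi.add_apply, mul_add]
      map_smul' := fun c F => by
        rw [RingHom.id_apply, ← MemLp.toLp_const_smul]
        refine MemLp.toLp_congr _ _ ?_
        filter_upwards [Lp.coeFn_smul c F] with t ht
        simp only [ht, Pi.smul_apply, smul_eq_mul]
        ring }
    1 fun F => by
      rw [one_mul]
      apply Lp.norm_le_norm_of_ae_le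
      filter_upwards [(damp_memLp σ F).coeFn_toLp] with t ht
      simp only [LinearMap.coe_mk, AddHom.coe_mk]
      rw [ht, norm_mul]
      exact mul_le_of_le_one_left (norm_nonneg _) (norm_exp_neg_le σ t)

theorem damp_ae (σ : ℝ) (F : Lp ℂ 2 (volume : Measure ℝ)) :
    damp σ F =ᵐ[volume] fun t => (Real.exp (-(σ ^ 2 / 4 * t ^ 2)) : ℂ) * F t :=
  (damp_memLp σ F).coeFn_toLp

theorem exp_mul_exp_neg (σ t : ℝ) :
    (Real.exp (σ ^ 2 / 4 * t ^ 2) : ℂ) * (Real.exp (-(σ ^ 2 / 4 * t ^ 2)) : ℂ) = 1 := by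
  rw [← Complex.ofReal_mul, ← Real.exp_add, add_neg_cancel, Real.exp_zero, Complex.ofReal_one]

theorem range_embed :
    Set.range (embed σ) = damp σ ⁻¹' Set.range (fourierIsometry) := by
  ext F
  constructor
  · rintro ⟨f, rfl⟩
    refine ⟨toL2 f, Lp.ext ?_⟩
    filter_upwards [fourierIsometry_ae (toL2 f), damp_ae σ (embed σ f), embed_ae f] with t h1 h2 h3
    rw [h1, h2, h3, weighted, ← mul_assoc, mul_comm (Complex.ofReal _), exp_mul_exp_neg, one_mul]
  · rintro ⟨f, hf⟩
    have h : weighted σ f =ᵐ[volume] F := by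
      have h2 := damp_ae σ F
      rw [← hf] at h2
      filter_upwards [fourierIsometry_ae f, h2] with t h1 h2
      rw [weighted, ← h1, h2, ← mul_assoc, exp_mul_exp_neg, one_mul]
    have hm : f ∈ gaussianSubmodule σ :=
      (weighted_memLp_iff σ f).1 ((memLp_congr_ae h).2 (Lp.memLp F))
    refine ⟨(⟨f, hm⟩ : gaussianSubmodule σ), Lp.ext ?_⟩
    exact (embed_ae _).trans h

instance instCompleteSpace : CompleteSpace (GaussianRKHS σ) := by
  let Φ : GaussianRKHS σ →ₗᵢ[ℝ] Lp ℂ 2 (volume : Measure ℝ) := ⟨embed σ, norm_embed⟩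
  rw [completeSpace_iff_isComplete_range Φ.isometry.isUniformInducing]
  apply IsClosed.isComplete
  change IsClosed (Set.range (embed σ))
  rw [range_embed]
  exact (fourierIsometry.isometry.isClosedEmbedding.isClosed_range).preimage (damp σ).continuous

end GaussianRKHS

section Covariance

theorem gaussianReal_le (μ : ℝ) {v : NNReal} (hv : v ≠ 0) :
    gaussianReal μ v ≤ ENNReal.ofReal (√(2 * Real.pi * v))⁻¹ • volume := by
  rw [gaussianReal_of_var_ne_zero μ hv, ← withDensity_const]
  refine withDensity_mono (Filter.Eventually.of_forall fun x => ENNReal.ofReal_le_ofReal ?_)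
  rw [gaussianPDFReal]
  refine mul_le_of_le_one_right (by positivity) (Real.exp_le_one_iff.2 ?_)
  have : 0 ≤ (x - μ) ^ 2 / (2 * (v : ℝ)) := by positivity
  rw [neg_div]
  linarith

theorem integrable_mul_gaussian (μ : ℝ) {v : NNReal} (hv : v ≠ 0)
    (f g : Lp ℝ 2 (volume : Measure ℝ)) :
    Integrable (fun x => f x * g x) (gaussianReal μ v) :=
  (((Lp.memLp f).integrable_mul (Lp.memLp g)).smul_measure ENNReal.ofReal_ne_top).mono_measure
    (gaussianReal_le μ hv)

theorem abs_integral_mul_gaussian_le (μ : ℝ) {v : NNReal} (hv : v ≠ 0)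
    (f g : Lp ℝ 2 (volume : Measure ℝ)) :
    |∫ x, f x * g x ∂gaussianReal μ v| ≤ (√(2 * Real.pi * v))⁻¹ * (‖f‖ * ‖g‖) := by
  have hi : Integrable (fun x => f x * g x) volume := (Lp.memLp f).integrable_mul (Lp.memLp g)
  have h1 : ∫ x, ‖f x * g x‖ ∂gaussianReal μ v ≤
      ∫ x, ‖f x * g x‖ ∂(ENNReal.ofReal (√(2 * Real.pi * v))⁻¹ • (volume : Measure ℝ)) :=
    integral_mono_measure (gaussianReal_le μ hv)
      (Filter.Eventually.of_forall fun x => norm_nonneg _)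
      (hi.norm.smul_measure ENNReal.ofReal_ne_top)
  rw [integral_smul_measure, ENNReal.toReal_ofReal (by positivity), smul_eq_mul] at h1
  refine (norm_integral_le_integral_norm _).trans (h1.trans ?_)
  refine mul_le_mul_of_nonneg_left ?_ (by positivity)
  have h2 : ∫ x, ‖f x * g x‖ = inner ℝ (|f|) (|g|) := by
    rw [L2.inner_def]
    apply integral_congr_ae
    filter_upwards [Lp.coeFn_abs f, Lp.coeFn_abs g] with x hf hg
    rw [hf, hg, norm_mul, real_inner_comm, RCLike.inner_apply, conj_trivial]
    rfl
  rw [h2]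
  exact (real_inner_le_norm _ _).trans_eq (by rw [norm_abs_eq_norm, norm_abs_eq_norm])

variable {Ω : Type*} [MeasurableSpace Ω] {P : Measure Ω} {X : Ω → ℝ} {μ σ₀ : ℝ}

theorem var_ne_zero (hσ₀ : 0 < σ₀) : (σ₀ ^ 2).toNNReal ≠ 0 :=
  (Real.toNNReal_pos.2 (by positivity)).ne'

theorem integral_comp_law (hX : HasLaw X (gaussianReal μ (σ₀ ^ 2).toNNReal) P) (hσ₀ : 0 < σ₀)
    (f g : Lp ℝ 2 (volume : Measure ℝ)) :
    ∫ ω, f (X ω) * g (X ω) ∂P = ∫ x, f x * g x ∂gaussianReal μ (σ₀ ^ 2).toNNReal :=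
  hX.integral_comp (f := fun x => f x * g x)
    (integrable_mul_gaussian μ (var_ne_zero hσ₀) f g).aestronglyMeasurable

/-- The bounded bilinear form `(f, g) ↦ E[f(X) g(X)]` on `H_G`, for `X ~ N(μ, σ₀²)`. It does not
depend on the representatives of `f` and `g`, as the law of `X` has a density. -/
def covForm (σ : ℝ) (hσ₀ : 0 < σ₀) (hX : HasLaw X (gaussianReal μ (σ₀ ^ 2).toNNReal) P) :
    GaussianRKHS σ →L[ℝ] GaussianRKHS σ →L[ℝ] ℝ :=
  LinearMap.mkContinuous₂
    (LinearMap.mk₂ ℝ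
      (fun f g => ∫ ω, GaussianRKHS.toL2 f (X ω) * GaussianRKHS.toL2 g (X ω) ∂P)
      (fun f f' g => by
        simp only [integral_comp_law hX hσ₀]
        rw [← integral_add (integrable_mul_gaussian μ (var_ne_zero hσ₀) _ _)
          (integrable_mul_gaussian μ (var_ne_zero hσ₀) _ _), map_add]
        apply integral_congr_ae
        filter_upwards [(gaussianReal_absolutelyContinuous μ (var_ne_zero hσ₀)).ae_le
          (Lp.coeFn_add (GaussianRKHS.toL2 f) (GaussianRKHS.toL2 f'))] with x hx
        rw [hx, Pi.add_apply, add_mul])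
      (fun c f g => by
        simp only [integral_comp_law hX hσ₀]
        rw [smul_eq_mul, ← integral_const_mul, map_smul]
        apply integral_congr_ae
        filter_upwards [(gaussianReal_absolutelyContinuous μ (var_ne_zero hσ₀)).ae_le
          (Lp.coeFn_smul c (GaussianRKHS.toL2 f))] with x hx
        rw [hx, Pi.smul_apply, smul_eq_mul, mul_assoc])
      (fun f g g' => by
        simp only [integral_comp_law hX hσ₀]
        rw [← integral_add (integrable_mul_gaussian μ (var_ne_zero hσ₀) _ _)
          (integrable_mul_gaussian μ (var_ne_zero hσ₀) _ _), map_add]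
        apply integral_congr_ae
        filter_upwards [(gaussianReal_absolutelyContinuous μ (var_ne_zero hσ₀)).ae_le
          (Lp.coeFn_add (GaussianRKHS.toL2 g) (GaussianRKHS.toL2 g'))] with x hx
        rw [hx, Pi.add_apply, mul_add])
      (fun c f g => by
        simp only [integral_comp_law hX hσ₀]
        rw [smul_eq_mul, ← integral_const_mul, map_smul]
        apply integral_congr_ae
        filter_upwards [(gaussianReal_absolutelyContinuous μ (var_ne_zero hσ₀)).ae_le
          (Lp.coeFn_smul c (GaussianRKHS.toL2 g))] with x hx
        rw [hx, Pi.smul_apply, smul_eq_mul]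
        ring))
    (√(2 * Real.pi * (σ₀ ^ 2).toNNReal))⁻¹
    (fun f g => by
      rw [LinearMap.mk₂_apply, integral_comp_law hX hσ₀, mul_assoc]
      refine (abs_integral_mul_gaussian_le μ (var_ne_zero hσ₀) _ _).trans ?_
      gcongr
      · exact GaussianRKHS.norm_toL2_le f
      · exact GaussianRKHS.norm_toL2_le g)

/-- The covariance operator `C_XX : H_G → H_G` of `X ~ N(μ, σ₀²)`, the bounded linear operator that
represents the form `E[f(X) g(X)]`. -/
def covOp (σ : ℝ) (hσ₀ : 0 < σ₀) (hX : HasLaw X (gaussianReal μ (σ₀ ^ 2).toNNReal) P) :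
    GaussianRKHS σ →L[ℝ] GaussianRKHS σ :=
  InnerProductSpace.continuousLinearMapOfBilin (𝕜 := ℝ) (covForm σ hσ₀ hX)

/-- The defining property of `C_XX`. -/
theorem inner_covOp (σ : ℝ) (hσ₀ : 0 < σ₀)
    (hX : HasLaw X (gaussianReal μ (σ₀ ^ 2).toNNReal) P) (f g : GaussianRKHS σ) :
    inner ℝ (covOp σ hσ₀ hX f) g =
      ∫ ω, GaussianRKHS.toL2 f (X ω) * GaussianRKHS.toL2 g (X ω) ∂P :=
  InnerProductSpace.continuousLinearMapOfBilin_apply (𝕜 := ℝ) (covForm σ hσ₀ hX) f g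

end Covariance

end KernelBayes

end

namespace KernelBayes

open Filter Topology Convolution RealInnerProductSpace

section FourierIntegral

variable {V F : Type*} [NormedAddCommGroup V] [InnerProductSpace ℝ V] [FiniteDimensional ℝ V]
  [MeasurableSpace V] [BorelSpace V]

theorem fourier_comp_sub_right [NormedAddCommGroup F] [NormedSpace ℂ F] (f : V → F) (a w : V) :
    𝓕 (fun x => f (x - a)) w = Real.fourierChar (-⟪a, w⟫) • 𝓕 f w := by
  have h := congrFun (VectorFourier.fourierIntegral_comp_add_right Real.fourierChar volume
    (innerₗ V) f (-a)) w
  simp only [Function.comp_def, ← sub_eq_add_neg, innerₗ_apply_apply, inner_neg_left] at h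
  exact h

/-- Both sides are locally integrable, so it suffices to pair them with test functions, where the
Fourier transform can be moved to the test function. -/
theorem Lp_fourier_ae_eq [NormedAddCommGroup F] [InnerProductSpace ℂ F] [CompleteSpace F]
    {f : Lp F 2 (volume : Measure V)} {g : V → F} (hfg : f =ᵐ[volume] g) (hg : Integrable g) :
    (𝓕 f : Lp F 2 (volume : Measure V)) =ᵐ[volume] 𝓕 g := by
  have hcont : Continuous (𝓕 g) :=
    VectorFourier.fourierIntegral_continuous Real.continuous_fourierChar continuous_inner hg
  refine ae_eq_of_integral_contDiff_smul_eq ((Lp.memLp _).locallyIntegrable one_le_two)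
    hcont.locallyIntegrable fun φ hφ hφc => ?_
  let ψ : SchwartzMap V ℂ :=
    (hφc.comp_left (g := Complex.ofRealCLM) rfl).toSchwartzMap (by fun_prop)
  calc ∫ x, φ x • (𝓕 f : Lp F 2 (volume : Measure V)) x
      = ∫ x, 𝓕 ψ x • f x := by
        have h := congrArg (· ψ) (Lp.fourier_toTemperedDistribution_eq f)
        simpa [ψ] using h.symm
    _ = ∫ x, 𝓕 (ψ : V → ℂ) x • g x := by
        rw [SchwartzMap.fourier_coe]
        exact integral_congr_ae (hfg.mono fun x hx => by simp only [hx])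
    _ = ∫ x, ψ x • 𝓕 g x := by
        simpa using! VectorFourier.integral_fourierIntegral_smul_eq_flip (L := innerₗ V)
          Real.continuous_fourierChar continuous_inner ψ.integrable hg
    _ = ∫ x, φ x • 𝓕 g x := by simp [ψ]

/-- If `c ≠ 0`, then `|𝓕 u| = |c|` wherever `𝓕 g` does not vanish, against Riemann–Lebesgue. -/
theorem eq_zero_of_convolution_eq_smul_comp_sub {u g : V → ℂ} (hu : Integrable u)
    (hg : Integrable g) (hg₀ : ∃ᶠ w in cocompact V, 𝓕 g w ≠ 0) {c : ℂ} {a : V}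
    (h : u ⋆[ContinuousLinearMap.mul ℂ ℂ] g =ᵐ[volume] c • fun x => g (x - a)) : c = 0 := by
  have hnorm (w : V) (hw : 𝓕 g w ≠ 0) : ‖𝓕 u w‖ = ‖c‖ := by
    have hmul : 𝓕 u w * 𝓕 g w = c • Real.fourierChar (-⟪a, w⟫) • 𝓕 g w := by
      rw [← Real.fourier_mul_convolution_eq hu hg, Real.fourier_congr_ae h,
        ← fourier_comp_sub_right]
      exact congrFun (VectorFourier.fourierIntegral_const_smul _ _ _ _ _) w
    have := congrArg norm hmul
    rwa [norm_mul, norm_smul, Circle.norm_smul, mul_left_inj' (norm_ne_zero_iff.2 hw)] at this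
  have hlim : Tendsto (fun w => ‖𝓕 u w‖) (cocompact V) (𝓝 0) := by
    simpa using! (tendsto_integral_exp_inner_smul_cocompact u).norm
  by_contra hc
  obtain ⟨w, hw, hlt⟩ := (hg₀.and_eventually (hlim.eventually_lt_const (norm_pos_iff.2 hc))).exists
  exact hlt.ne (hnorm w hw)

end FourierIntegral

theorem fourierReal_toLp_ae {f : ℝ → ℝ} (hf : Integrable f) (hf₂ : MemLp f 2) :
    fourierReal (hf₂.toLp f) =ᵐ[volume] fun t =>
      ((√(2 * Real.pi))⁻¹ : ℝ) * 𝓕 (fun x => (f x : ℂ)) (t / (2 * Real.pi)) := by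
  have hcomplex : complexify (hf₂.toLp f) =ᵐ[volume] fun x => (f x : ℂ) := by
    filter_upwards [Complex.ofRealCLM.coeFn_compLp (hf₂.toLp f), hf₂.coeFn_toLp] with x h₁ h₂
    rw [complexify, h₁, h₂, Complex.ofRealCLM_apply]
  filter_upwards [quasi_dilate.ae (Lp_fourier_ae_eq hcomplex hf.ofReal)] with t ht
  rw [fourierReal, fourierL2, ht]

theorem integrable_gaussianPDFReal_smul {E : Type*} [NormedAddCommGroup E] [NormedSpace ℝ E]
    (μ : ℝ) {v : NNReal} (hv : v ≠ 0) {p : ENNReal} (hp : 1 ≤ p) {f : ℝ → E} (hf : MemLp f p) :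
    Integrable fun x => gaussianPDFReal μ v x • f x := by
  have h : Integrable f (gaussianReal μ v) :=
    ((hf.smul_measure ENNReal.ofReal_ne_top).mono_measure (gaussianReal_le μ hv)).integrable hp
  rw [gaussianReal_of_var_ne_zero μ hv, integrable_withDensity_iff_integrable_smul'
    (measurable_gaussianPDF μ v) (ae_of_all _ fun _ => gaussianPDF_lt_top)] at h
  simpa only [toReal_gaussianPDF] using h

theorem integral_cexp_mul_exp_neg_mul_sq {b : ℝ} (hb : 0 < b) (t : ℝ) :
    ∫ x : ℝ, Complex.exp (Complex.I * t * x) * (Real.exp (-b * x ^ 2) : ℂ) =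
      (√(Real.pi / b) * Real.exp (-t ^ 2 / (4 * b)) : ℝ) := by
  have h := fourierIntegral_gaussian (b := b) (by simpa using hb) t
  rw [Real.sqrt_eq_rpow, Complex.ofReal_mul, Complex.ofReal_cpow (by positivity)]
  push_cast
  exact h

theorem exp_neg_mul_mul_exp_mul (x y : ℝ) : Real.exp (-x * y) * Real.exp (x * y) = 1 := by
  rw [← Real.exp_add, neg_mul, neg_add_cancel, Real.exp_zero]

/-- The centred Gaussian of standard deviation `σ`, normalised to have value `1` at the origin: the
translates of `gaussian σ` are the functions `k_a` of the theorem. -/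
noncomputable def gaussian (σ x : ℝ) : ℝ := Real.exp (-x ^ 2 / (2 * σ ^ 2))

section Gaussian

variable {σ : ℝ}

theorem gaussian_eq (σ x : ℝ) : gaussian σ x = Real.exp (-(2 * σ ^ 2)⁻¹ * x ^ 2) := by
  rw [gaussian]
  ring_nf

theorem gaussian_sub_comm (σ x y : ℝ) : gaussian σ (x - y) = gaussian σ (y - x) := by
  rw [gaussian, gaussian, sub_sq_comm]

theorem integrable_gaussian (hσ : σ ≠ 0) : Integrable (gaussian σ) :=
  (integrable_exp_neg_mul_sq (b := (2 * σ ^ 2)⁻¹) (by positivity)).congr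
    (ae_of_all _ fun x => (gaussian_eq σ x).symm)

theorem memLp_two_gaussian (hσ : σ ≠ 0) : MemLp (gaussian σ) 2 := by
  rw [memLp_two_iff_integrable_sq (integrable_gaussian hσ).aestronglyMeasurable]
  refine (integrable_exp_neg_mul_sq (b := (σ ^ 2)⁻¹) (by positivity)).congr
    (ae_of_all _ fun x => ?_)
  change _ = gaussian σ x ^ 2
  rw [gaussian, ← Real.exp_nat_mul]
  push_cast
  field_simp

theorem memLp_two_gaussian_comp_sub (hσ : σ ≠ 0) (a : ℝ) :
    MemLp (fun x => gaussian σ (x - a)) 2 :=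
  (memLp_two_gaussian hσ).comp_measurePreserving (measurePreserving_sub_right volume a)

theorem fourier_gaussian (hσ : 0 < σ) (w : ℝ) :
    𝓕 (fun x => (gaussian σ x : ℂ)) w =
      (√(2 * Real.pi) * σ * Real.exp (-(σ ^ 2 / 2) * (2 * Real.pi * w) ^ 2) : ℝ) := by
  have hsqrt : √(Real.pi / (2 * σ ^ 2)⁻¹) = √(2 * Real.pi) * σ := by
    rw [div_inv_eq_mul, ← mul_assoc, mul_comm Real.pi, Real.sqrt_mul (by positivity),
      Real.sqrt_sq hσ.le]
  have hexp : -(-(2 * Real.pi * w)) ^ 2 / (4 * (2 * σ ^ 2)⁻¹) =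
      -(σ ^ 2 / 2) * (2 * Real.pi * w) ^ 2 := by field
  rw [← hsqrt, ← hexp, ← integral_cexp_mul_exp_neg_mul_sq (by positivity),
    Real.fourier_real_eq_integral_exp_smul]
  refine integral_congr_ae (ae_of_all _ fun x => ?_)
  simp only [smul_eq_mul, gaussian_eq]
  push_cast
  ring_nf

theorem fourier_gaussian_ne_zero (hσ : 0 < σ) (w : ℝ) :
    𝓕 (fun x => (gaussian σ x : ℂ)) w ≠ 0 := by
  rw [fourier_gaussian hσ, Complex.ofReal_ne_zero]
  positivity

theorem fourierReal_gaussian_comp_sub (hσ : 0 < σ) (a : ℝ) :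
    fourierReal ((memLp_two_gaussian_comp_sub hσ.ne' a).toLp _) =ᵐ[volume] fun t =>
      Complex.exp (-(t * a) * Complex.I) * (σ * Real.exp (-(σ ^ 2 / 2) * t ^ 2) : ℝ) := by
  filter_upwards [fourierReal_toLp_ae ((integrable_gaussian hσ.ne').comp_sub_right a)
    (memLp_two_gaussian_comp_sub hσ.ne' a)] with t ht
  have hsqrt : ((√(2 * Real.pi) : ℝ) : ℂ) ≠ 0 := by
    rw [Complex.ofReal_ne_zero]
    positivity
  have hphase : 2 * Real.pi * -⟪a, t / (2 * Real.pi)⟫ = -(t * a) := by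
    rw [RCLike.inner_apply, conj_trivial]
    field
  rw [ht, fourier_comp_sub_right (fun x => (gaussian σ x : ℂ)), fourier_gaussian hσ,
    mul_div_cancel₀ _ two_pi_pos.ne', Circle.smul_def, Real.fourierChar_apply, hphase]
  push_cast
  rw [smul_eq_mul]
  field_simp

theorem gaussian_comp_sub_mem_gaussianSubmodule (hσ : 0 < σ) (a : ℝ) :
    (memLp_two_gaussian_comp_sub hσ.ne' a).toLp _ ∈ gaussianSubmodule σ := by
  change Integrable fun t => ‖fourierReal _ t‖ ^ 2 * Real.exp (σ ^ 2 / 2 * t ^ 2)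
  refine ((integrable_exp_neg_mul_sq (b := σ ^ 2 / 2) (by positivity)).const_mul (σ ^ 2)).congr ?_
  filter_upwards [fourierReal_gaussian_comp_sub hσ a] with t ht
  have hphase : ‖Complex.exp (-(t * a) * Complex.I)‖ = 1 := by
    exact_mod_cast Complex.norm_exp_ofReal_mul_I (-(t * a))
  rw [ht, norm_mul, hphase, one_mul, Complex.norm_real, Real.norm_eq_abs, sq_abs]
  linear_combination (-σ ^ 2 * Real.exp (-(σ ^ 2 / 2) * t ^ 2)) *
    exp_neg_mul_mul_exp_mul (σ ^ 2 / 2) (t ^ 2)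

theorem fourierReal_gaussian_comp_sub_mul_conj (hσ : 0 < σ) (a b : ℝ) :
    (fun t => fourierReal ((memLp_two_gaussian_comp_sub hσ.ne' a).toLp _) t *
      (starRingEnd ℂ) (fourierReal ((memLp_two_gaussian_comp_sub hσ.ne' b).toLp _) t) *
        (Real.exp (σ ^ 2 / 2 * t ^ 2) : ℂ)) =ᵐ[volume]
      fun t => ((σ ^ 2 : ℝ) : ℂ) * (Complex.exp (Complex.I * (b - a : ℝ) * t) *
        (Real.exp (-(σ ^ 2 / 2) * t ^ 2) : ℂ)) := by
  filter_upwards [fourierReal_gaussian_comp_sub hσ a,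
    fourierReal_gaussian_comp_sub hσ b] with t ha hb
  have hphase : Complex.exp (-(t * a) * Complex.I) *
      (starRingEnd ℂ) (Complex.exp (-(t * b) * Complex.I)) =
        Complex.exp (Complex.I * (b - a : ℝ) * t) := by
    rw [← Complex.exp_conj, ← Complex.exp_add]
    simp only [map_mul, map_neg, Complex.conj_ofReal, Complex.conj_I]
    push_cast
    ring_nf
  have hweight := congrArg Complex.ofReal (exp_neg_mul_mul_exp_mul (σ ^ 2 / 2) (t ^ 2))
  rw [Complex.ofReal_mul, Complex.ofReal_one] at hweight
  rw [ha, hb, ← hphase, map_mul, Complex.conj_ofReal]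
  simp only [Complex.ofReal_mul, Complex.ofReal_pow]
  linear_combination (σ ^ 2 * Complex.exp (-(t * a) * Complex.I) *
    (starRingEnd ℂ) (Complex.exp (-(t * b) * Complex.I)) *
      (Real.exp (-(σ ^ 2 / 2) * t ^ 2) : ℂ)) * hweight

end Gaussian

namespace GaussianRKHS

variable {σ : ℝ}

/-- The function `x ↦ exp (-(x - a) ^ 2 / (2 * σ ^ 2))`, called `k_a` in the theorem, as an element
of `H_G`. -/
noncomputable def translatedGaussian (hσ : 0 < σ) (a : ℝ) : GaussianRKHS σ :=
  (⟨_, gaussian_comp_sub_mem_gaussianSubmodule hσ a⟩ : gaussianSubmodule σ)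

theorem toL2_translatedGaussian (hσ : 0 < σ) (a : ℝ) :
    toL2 (translatedGaussian hσ a) =ᵐ[volume] fun x => gaussian σ (x - a) :=
  (memLp_two_gaussian_comp_sub hσ.ne' a).coeFn_toLp

theorem inner_translatedGaussian (hσ : 0 < σ) (a b : ℝ) :
    inner ℝ (translatedGaussian hσ a) (translatedGaussian hσ b) =
      √(2 * Real.pi) * σ * gaussian σ (b - a) := by
  have hintegral : ∫ t : ℝ, fourierReal (toL2 (translatedGaussian hσ a)) t *
      (starRingEnd ℂ) (fourierReal (toL2 (translatedGaussian hσ b)) t) *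
        (Real.exp (σ ^ 2 / 2 * t ^ 2) : ℂ) =
      ∫ t : ℝ, ((σ ^ 2 : ℝ) : ℂ) * (Complex.exp (Complex.I * (b - a : ℝ) * t) *
        (Real.exp (-(σ ^ 2 / 2) * t ^ 2) : ℂ)) :=
    integral_congr_ae (fourierReal_gaussian_comp_sub_mul_conj hσ a b)
  have hsqrt : σ ^ 2 * √(Real.pi / (σ ^ 2 / 2)) = √(2 * Real.pi) * σ := by
    rw [div_div_eq_mul_div, mul_comm Real.pi, Real.sqrt_div (by positivity), Real.sqrt_sq hσ.le]
    field
  have hexp : Real.exp (-(b - a) ^ 2 / (4 * (σ ^ 2 / 2))) = gaussian σ (b - a) := by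
    rw [gaussian]
    ring_nf
  rw [inner_def, innerG, hintegral, integral_const_mul,
    integral_cexp_mul_exp_neg_mul_sq (by positivity), ← Complex.ofReal_mul, Complex.ofReal_re,
    ← mul_assoc, hsqrt, hexp]

end GaussianRKHS

section Range

open GaussianRKHS

variable {Ω : Type*} [MeasurableSpace Ω] {P : Measure Ω} {X : Ω → ℝ} {μ σ₀ σ : ℝ}

theorem inner_covOp_translatedGaussian (hσ₀ : 0 < σ₀) (hσ : 0 < σ)
    (hX : HasLaw X (gaussianReal μ (σ₀ ^ 2).toNNReal) P) (f : GaussianRKHS σ) (b : ℝ) :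
    (inner ℝ (covOp σ hσ₀ hX f) (translatedGaussian hσ b) : ℂ) =
      ((fun x => ((gaussianPDFReal μ (σ₀ ^ 2).toNNReal x • toL2 f x : ℝ) : ℂ))
        ⋆[ContinuousLinearMap.mul ℂ ℂ] fun x => (gaussian σ x : ℂ)) b := by
  rw [inner_covOp, integral_comp_law hX hσ₀,
    integral_gaussianReal_eq_integral_smul (var_ne_zero hσ₀), convolution_def,
    ← integral_complex_ofReal]
  refine integral_congr_ae ?_
  filter_upwards [toL2_translatedGaussian hσ b] with x hx
  rw [hx, gaussian_sub_comm, ContinuousLinearMap.mul_apply', ← Complex.ofReal_mul,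
    smul_mul_assoc]

theorem translatedGaussian_notMem_range_covOp (hσ₀ : 0 < σ₀) (hσ : 0 < σ)
    (hX : HasLaw X (gaussianReal μ (σ₀ ^ 2).toNNReal) P) (a : ℝ) :
    translatedGaussian hσ a ∉ Set.range (covOp σ hσ₀ hX) := by
  rintro ⟨f, hf⟩
  have hconv : ((fun x => ((gaussianPDFReal μ (σ₀ ^ 2).toNNReal x • toL2 f x : ℝ) : ℂ))
      ⋆[ContinuousLinearMap.mul ℂ ℂ] fun x => (gaussian σ x : ℂ)) =
      ((√(2 * Real.pi) * σ : ℝ) : ℂ) • fun x => (gaussian σ (x - a) : ℂ) := by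
    funext b
    rw [← inner_covOp_translatedGaussian hσ₀ hσ hX, hf, inner_translatedGaussian,
      Complex.ofReal_mul, Pi.smul_apply, smul_eq_mul]
  have hzero := eq_zero_of_convolution_eq_smul_comp_sub
    (integrable_gaussianPDFReal_smul μ (var_ne_zero hσ₀) one_le_two (Lp.memLp (toL2 f))).ofReal
    (integrable_gaussian hσ.ne').ofReal
    (Eventually.of_forall fun w => fourier_gaussian_ne_zero hσ w).frequently hconv.eventuallyEq
  have hpos : 0 < √(2 * Real.pi) * σ := by positivity
  exact hpos.ne' (Complex.ofReal_eq_zero.1 hzero)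

end Range

end KernelBayes

theorem mainTheorem1 {Ω : Type*} [MeasurableSpace Ω] (P : Measure Ω) (X : Ω → ℝ)
    (μ σ₀ σ : ℝ) (hσ₀ : 0 < σ₀) (hσ : 0 < σ)
    (hX : HasLaw X (gaussianReal μ (σ₀ ^ 2).toNNReal) P) :
    (∀ a : ℝ, ∃ k : KernelBayes.GaussianRKHS σ,
      (KernelBayes.GaussianRKHS.toL2 k =ᵐ[volume]
        fun x : ℝ => Real.exp (-(x - a) ^ 2 / (2 * σ ^ 2))) ∧
      k ∉ Set.range (KernelBayes.covOp σ hσ₀ hX)) ∧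
    ¬ Function.Surjective (KernelBayes.covOp σ hσ₀ hX) := by
  have hrange (a : ℝ) : KernelBayes.GaussianRKHS.translatedGaussian hσ a ∉
      Set.range (KernelBayes.covOp σ hσ₀ hX) :=
    KernelBayes.translatedGaussian_notMem_range_covOp hσ₀ hσ hX a
  exact ⟨fun a => ⟨_, KernelBayes.GaussianRKHS.toL2_translatedGaussian hσ a, hrange a⟩,
    fun hsurj => hrange 0 (hsurj _)⟩
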